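/- Let $K$ be a field, let $m\ge 2$ be an integer and let $q\in K$ be a primitive $m$-th root of unity. The Taft algebra $T_{m^2}(q)$ is the Hopf $K$-algebra generated as an algebra by $h$ and $x$ subject to $h^m=1$, $x^m=0$, $xh=q\,hx$, with $\Delta(h)=h\otimes h$, $\Delta(x)=x\otimes h+1\otimes x$, $\varepsilon(h)=1$, $\varepsilon(x)=0$, $S(h)=h^{m-1}$, $S(x)=-xh^{m-1}$. A Hopf algebra $E$ *factorizes through* Hopf algebras $A$ and $H$ if there are injective Hopf algebra maps $i:A\to E$ and $j:H\to E$ such that $A\otimes H\to E$, $a\otimes y\mapsto i(a)j(y)$, is bijective. A *matched pair* $(A,H,\triangleleft,\triangleright)$ of Hopf algebras consists of linear maps $\triangleright:H\otimes A\to A$ and $\triangleleft:H\otimes A\to H$ making $A$ a left $H$-module coalgebra and $H$ a right $A$-module coalgebra such that, for all $a,b\in A$ and $y,z\in H$ (Sweedler notation), $$y\triangleright 1=\varepsilon(y)1,\qquad 1\triangleleft a=\varepsilon(a)1,$$ $$y\triangleright(ab)=(y_{(1)}\triangleright a_{(1)})\bigl((y_{(2)}\triangleleft a_{(2)})\triangleright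 b\bigr),\qquad (yz)\triangleleft a=\bigl(y\triangleleft(z_{(1)}\triangleright a_{(1)})\bigr)(z_{(2)}\triangleleft a_{(2)}),$$ $$y_{(1)}\triangleleft a_{(1)}\otimes y_{(2)}\triangleright a_{(2)}=y_{(2)}\triangleleft a_{(2)}\otimes y_{(1)}\triangleright a_{(1)}.$$ The right action is *trivial* if $y\triangleleft a=\varepsilon(a)y$ for all $a\in A$, $y\in H$. If $A$ is a left $H$-module coalgebra and a left $H$-module algebra via $\triangleright:H\otimes A\to A$, and $y_{(1)}\otimes y_{(2)}\triangleright a=y_{(2)}\otimes y_{(1)}\triangleright a$ for all $y\in H$, $a\in A$, then the *smash product* $A\#H$ is the Hopf algebra whose underlying coalgebra is the tensor product coalgebra $A\otimes H$ and whose multiplication is $(a\#y)(b\#z)=a(y_{(1)}\triangleright b)\#y_{(2)}z$, with unit $1\#1$. **Theorem.** Let $G$ be a group that has a generating set consisting of elements of finite order, and let $K[G]$ be its group Hopf algebra. Then: 1. every Hopf algebra over $K$ that factorizes through $T_{m^2}(q)$ and $K[G]$ is isomorphic, as a Hopf algebra, to a smash product $T_{m^2}(q)\#K[G]$ for some such left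 action $\triangleright$ of $K[G]$ on $T_{m^2}(q)$; 2. in every matched pair $(T_{m^2}(q),K[G],\triangleleft,\triangleright)$ of Hopf algebras, the right action $\triangleleft$ is trivial. -/

import Mathlib

open scoped TensorProduct

section QBinomial

/-- The `q`-binomial coefficient, indexed by the two lower parts. -/
def qBinom {K : Type*} [Field K] (q : K) : ℕ → ℕ → K
  | 0, _ => 1
  | _ + 1, 0 => 1
  | i + 1, j + 1 => qBinom q i (j + 1) + q ^ (i + 1) * qBinom q (i + 1) j

theorem qBinom_mul_prod {K : Type*} [Field K] (q : K) : ∀ i j : ℕ,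
    qBinom q i j * (∏ k ∈ Finset.range i, ∑ l ∈ Finset.range (k + 1), q ^ l) *
      (∏ k ∈ Finset.range j, ∑ l ∈ Finset.range (k + 1), q ^ l) =
    ∏ k ∈ Finset.range (i + j), ∑ l ∈ Finset.range (k + 1), q ^ l
  | 0, j => by simp [qBinom]
  | i + 1, 0 => by simp [qBinom]
  | i + 1, j + 1 => by
    have h1 := qBinom_mul_prod q i (j + 1)
    have h2 := qBinom_mul_prod q (i + 1) j
    have hs : ∑ l ∈ Finset.range (i + 1 + j + 1), q ^ l =
        (∑ l ∈ Finset.range (i + 1), q ^ l) +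
          q ^ (i + 1) * ∑ l ∈ Finset.range (j + 1), q ^ l := by
      rw [show i + 1 + j + 1 = (i + 1) + (j + 1) by ring, Finset.sum_range_add, Finset.mul_sum]
      simp [pow_add]
    rw [show i + (j + 1) = i + 1 + j by ring, Finset.prod_range_succ _ j] at h1
    rw [Finset.prod_range_succ _ i] at h2
    rw [qBinom, show i + 1 + (j + 1) = (i + 1 + j) + 1 by ring, Finset.prod_range_succ _ (i + 1 + j),
      hs, Finset.prod_range_succ _ i, Finset.prod_range_succ _ j]
    linear_combination (∑ l ∈ Finset.range (i + 1), q ^ l) * h1 +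
      q ^ (i + 1) * (∑ l ∈ Finset.range (j + 1), q ^ l) * h2

theorem qBinom_eq_zero {K : Type*} [Field K] {q : K} {m i j : ℕ} (hq : IsPrimitiveRoot q m)
    (hm : i + 1 + (j + 1) = m) : qBinom q (i + 1) (j + 1) = 0 := by
  have hne : ∀ n < m, ∏ k ∈ Finset.range n, ∑ l ∈ Finset.range (k + 1), q ^ l ≠ 0 := by
    intro n hn
    rw [Finset.prod_ne_zero_iff]
    intro k hk h0
    have hk' := Finset.mem_range.1 hk
    have h1 := geom_sum_mul q (k + 1)
    rw [h0, zero_mul] at h1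
    exact hq.pow_ne_one_of_pos_of_lt (Nat.succ_ne_zero k) (by omega) (sub_eq_zero.1 h1.symm)
  have h := qBinom_mul_prod q (i + 1) (j + 1)
  rw [hm, show m = (m - 1) + 1 by omega, Finset.prod_range_succ _ (m - 1),
    show m - 1 + 1 = m by omega, hq.geom_sum_eq_zero (by omega), mul_zero] at h
  rcases mul_eq_zero.1 h with h | h
  · rcases mul_eq_zero.1 h with h | h
    · exact h
    · exact absurd h (hne _ (by omega))
  · exact absurd h (hne _ (by omega))

theorem add_pow_of_q_commute {K R : Type*} [Field K] [Ring R] [Algebra K R] (q : K) (a b : R)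
    (hab : b * a = q • (a * b)) (n : ℕ) :
    (a + b) ^ n = ∑ p ∈ Finset.HasAntidiagonal.antidiagonal n, qBinom q p.1 p.2 • (a ^ p.1 * b ^ p.2) := by
  have hpow : ∀ k : ℕ, b * a ^ k = q ^ k • (a ^ k * b) := by
    intro k
    induction k with
    | zero => simp
    | succ k ih =>
      rw [pow_succ, ← mul_assoc, ih, smul_mul_assoc, mul_assoc, hab, mul_smul_comm, smul_smul,
        ← mul_assoc, ← pow_succ]
  induction n with
  | zero => simp [qBinom]
  | succ n ih =>
    have hc : ∀ p ∈ Finset.HasAntidiagonal.antidiagonal (n + 1), qBinom q p.1 p.2 • (a ^ p.1 * b ^ p.2) =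
        (if p.1 = 0 then 0 else qBinom q (p.1 - 1) p.2 • (a ^ p.1 * b ^ p.2)) +
        (if p.2 = 0 then 0 else (q ^ p.1 * qBinom q p.1 (p.2 - 1)) • (a ^ p.1 * b ^ p.2)) := by
      rintro ⟨i, j⟩ hp
      rw [Finset.HasAntidiagonal.mem_antidiagonal] at hp
      rcases i with _ | i <;> rcases j with _ | j
      · simp at hp
      · simp [qBinom]
      · rcases i with _ | i <;> simp [qBinom]
      · simp [qBinom, add_smul]
    rw [Finset.sum_congr rfl hc, Finset.sum_add_distrib, Finset.Nat.sum_antidiagonal_succ,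
      Finset.Nat.sum_antidiagonal_succ', pow_succ', ih, add_mul, Finset.mul_sum, Finset.mul_sum]
    simp only [if_true, Nat.succ_ne_zero, if_false, zero_add, Nat.add_sub_cancel]
    congr 1
    · refine Finset.sum_congr rfl fun p _ => ?_
      rw [mul_smul_comm, ← mul_assoc, ← pow_succ']
    · refine Finset.sum_congr rfl fun p _ => ?_
      rw [mul_smul_comm, ← mul_assoc, hpow, smul_mul_assoc, mul_assoc, ← pow_succ', smul_smul,
        mul_comm]

theorem add_pow_eq_zero_of_q_commute {K R : Type*} [Field K] [Ring R] [Algebra K R] {q : K} {m : ℕ}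
    (hq : IsPrimitiveRoot q m) (a b : R) (hab : b * a = q • (a * b))
    (ha : a ^ m = 0) (hb : b ^ m = 0) : (a + b) ^ m = 0 := by
  rw [add_pow_of_q_commute q a b hab]
  refine Finset.sum_eq_zero ?_
  rintro ⟨i, j⟩ hp
  rw [Finset.HasAntidiagonal.mem_antidiagonal] at hp
  rcases i with _ | i
  · simp_all
  · rcases j with _ | j
    · simp_all
    · rw [qBinom_eq_zero hq hp, zero_smul]

end QBinomial

section Taft

/-- Names of the two generators of the Taft algebra. -/
inductive TaftGen : Type
  | h : TaftGen
  | x : TaftGen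

/-- The defining relations `h ^ m = 1`, `x ^ m = 0`, `x h = q h x`. -/
inductive TaftRel (K : Type*) [Field K] (m : ℕ) (q : K) :
    FreeAlgebra K TaftGen → FreeAlgebra K TaftGen → Prop
  | h_pow : TaftRel K m q (FreeAlgebra.ι K TaftGen.h ^ m) 1
  | x_pow : TaftRel K m q (FreeAlgebra.ι K TaftGen.x ^ m) 0
  | x_h : TaftRel K m q (FreeAlgebra.ι K TaftGen.x * FreeAlgebra.ι K TaftGen.h)
      (q • (FreeAlgebra.ι K TaftGen.h * FreeAlgebra.ι K TaftGen.x))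

/-- The Taft algebra `T_{m²}(q)`: the algebra generated by `h` and `x` subject to
`h ^ m = 1`, `x ^ m = 0`, `x h = q h x`. -/
def TaftAlgebra (K : Type*) [Field K] (m : ℕ) (q : K) : Type _ :=
  RingQuot (TaftRel K m q)

namespace TaftAlgebra

variable {K : Type*} [Field K] {m : ℕ} {q : K}

noncomputable instance : Ring (TaftAlgebra K m q) :=
  inferInstanceAs (Ring (RingQuot (TaftRel K m q)))

noncomputable instance instAlgebra : Algebra K (TaftAlgebra K m q) :=
  inferInstanceAs (Algebra K (RingQuot (TaftRel K m q)))

/-- The class of a generator. -/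
noncomputable def gen (K : Type*) [Field K] (m : ℕ) (q : K) (g : TaftGen) : TaftAlgebra K m q :=
  RingQuot.mkAlgHom K (TaftRel K m q) (FreeAlgebra.ι K g)

/-- The generator `h`. -/
noncomputable def h (K : Type*) [Field K] (m : ℕ) (q : K) : TaftAlgebra K m q := gen K m q .h

/-- The generator `x`. -/
noncomputable def x (K : Type*) [Field K] (m : ℕ) (q : K) : TaftAlgebra K m q := gen K m q .x

theorem h_pow : h K m q ^ m = 1 := by
  have := RingQuot.mkAlgHom_rel K (TaftRel.h_pow (K := K) (m := m) (q := q))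
  rwa [map_pow, map_one] at this

theorem x_pow : x K m q ^ m = 0 := by
  have := RingQuot.mkAlgHom_rel K (TaftRel.x_pow (K := K) (m := m) (q := q))
  rwa [map_pow, map_zero] at this

theorem x_mul_h : x K m q * h K m q = q • (h K m q * x K m q) := by
  have := RingQuot.mkAlgHom_rel K (TaftRel.x_h (K := K) (m := m) (q := q))
  rwa [map_mul, map_smul, map_mul] at this

/-- The universal property of the presentation. -/
noncomputable def lift {R : Type*} [Ring R] [Algebra K R] (a b : R) (ha : a ^ m = 1)
    (hb : b ^ m = 0) (hba : b * a = q • (a * b)) : TaftAlgebra K m q →ₐ[K] R :=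
  RingQuot.liftAlgHom K ⟨FreeAlgebra.lift K fun g => TaftGen.casesOn g a b, by
    rintro _ _ (_ | _ | _) <;> simpa⟩

section
variable {R : Type*} [Ring R] [Algebra K R] (a b : R) (ha : a ^ m = 1)
    (hb : b ^ m = 0) (hba : b * a = q • (a * b))

@[simp] theorem lift_h : lift a b ha hb hba (h K m q) = a := by
  unfold lift h gen
  erw [RingQuot.liftAlgHom_mkAlgHom_apply]
  simp

@[simp] theorem lift_x : lift a b ha hb hba (x K m q) = b := by
  unfold lift x gen
  erw [RingQuot.liftAlgHom_mkAlgHom_apply]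
  simp

end

theorem algHom_ext {R : Type*} [Semiring R] [Algebra K R] {f g : TaftAlgebra K m q →ₐ[K] R}
    (hh : f (h K m q) = g (h K m q)) (hx : f (x K m q) = g (x K m q)) : f = g := by
  refine RingQuot.ringQuot_ext' (S := K) (s := TaftRel K m q) f g (FreeAlgebra.hom_ext ?_)
  funext t
  rcases t with _ | _
  · exact hh
  · exact hx

theorem induction {P : TaftAlgebra K m q → Prop} (hc : ∀ c : K, P (algebraMap K _ c))
    (hh : P (h K m q)) (hx : P (x K m q)) (hadd : ∀ a b, P a → P b → P (a + b))
    (hmul : ∀ a b, P a → P b → P (a * b)) (a : TaftAlgebra K m q) : P a := by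
  obtain ⟨f, rfl⟩ := RingQuot.mkAlgHom_surjective K (TaftRel K m q) a
  induction f using FreeAlgebra.induction with
  | grade0 r => rw [AlgHom.commutes]; exact hc r
  | grade1 t => rcases t with _ | _; exacts [hh, hx]
  | mul a b ha hb => rw [map_mul]; exact hmul _ _ ha hb
  | add a b ha hb => rw [map_add]; exact hadd _ _ ha hb

/-- The comultiplication: `h ↦ h ⊗ h`, `x ↦ x ⊗ h + 1 ⊗ x`. -/
noncomputable def comulHom (hq : IsPrimitiveRoot q m) :
    TaftAlgebra K m q →ₐ[K] TaftAlgebra K m q ⊗[K] TaftAlgebra K m q :=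
  lift (h K m q ⊗ₜ h K m q) (x K m q ⊗ₜ h K m q + 1 ⊗ₜ x K m q)
    (by rw [Algebra.TensorProduct.tmul_pow, h_pow, Algebra.TensorProduct.one_def])
    (by
      apply add_pow_eq_zero_of_q_commute hq
      · simp [x_mul_h, TensorProduct.tmul_smul]
      · rw [Algebra.TensorProduct.tmul_pow, x_pow, TensorProduct.zero_tmul]
      · rw [Algebra.TensorProduct.tmul_pow, x_pow, TensorProduct.tmul_zero])
    (by
      simp [add_mul, mul_add, x_mul_h, TensorProduct.tmul_smul, TensorProduct.smul_tmul'])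

/-- The counit: `h ↦ 1`, `x ↦ 0`. -/
noncomputable def counitHom (hm : m ≠ 0) : TaftAlgebra K m q →ₐ[K] K :=
  lift 1 0 (one_pow m) (zero_pow hm) (by simp)

theorem h_mul_h_pow (hm : m ≠ 0) : h K m q * h K m q ^ (m - 1) = 1 := by
  rw [← pow_succ', Nat.sub_add_cancel (Nat.one_le_iff_ne_zero.2 hm), h_pow]

theorem h_pow_mul_h (hm : m ≠ 0) : h K m q ^ (m - 1) * h K m q = 1 := by
  rw [← pow_succ, Nat.sub_add_cancel (Nat.one_le_iff_ne_zero.2 hm), h_pow]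

theorem h_pow_mul_x (hm : m ≠ 0) :
    h K m q ^ (m - 1) * x K m q = q • (x K m q * h K m q ^ (m - 1)) := by
  have e : h K m q ^ (m - 1) * (x K m q * h K m q) * h K m q ^ (m - 1) =
      h K m q ^ (m - 1) * x K m q := by
    rw [mul_assoc, mul_assoc, h_mul_h_pow hm, mul_one]
  rw [← e, x_mul_h, mul_smul_comm, smul_mul_assoc, ← mul_assoc, h_pow_mul_h hm, one_mul]

theorem x_mul_h_pow_pow (hm : m ≠ 0) : (x K m q * h K m q ^ (m - 1)) ^ m = 0 := by
  have key : ∀ n : ℕ, ∃ c : K, ∃ r : TaftAlgebra K m q,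
      (x K m q * h K m q ^ (m - 1)) ^ n = c • (x K m q ^ n * r) := by
    have hx : ∀ n : ℕ, h K m q ^ (m - 1) * x K m q ^ n =
        q ^ n • (x K m q ^ n * h K m q ^ (m - 1)) := by
      intro n
      induction n with
      | zero => simp
      | succ n ih =>
        rw [pow_succ, ← mul_assoc, ih, smul_mul_assoc, mul_assoc, h_pow_mul_x hm, mul_smul_comm,
          smul_smul, ← pow_succ, mul_assoc]
    intro n
    induction n with
    | zero => exact ⟨1, 1, by simp⟩
    | succ n ih =>
      obtain ⟨c, r, e⟩ := ih
      refine ⟨c * q ^ n, h K m q ^ (m - 1) * r, ?_⟩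
      rw [pow_succ', e, mul_smul_comm, mul_assoc, ← mul_assoc (h K m q ^ (m - 1)), hx,
        smul_mul_assoc, mul_smul_comm, smul_smul, pow_succ' (x K m q)]
      simp only [mul_assoc]
  obtain ⟨c, r, e⟩ := key m
  rw [e, x_pow, zero_mul, smul_zero]

/-- The antipode as an algebra map to the opposite algebra: `h ↦ h ^ (m - 1)`,
`x ↦ - x h ^ (m - 1)`. -/
noncomputable def antipodeHom (hm : m ≠ 0) : TaftAlgebra K m q →ₐ[K] (TaftAlgebra K m q)ᵐᵒᵖ :=
  lift (MulOpposite.op (h K m q ^ (m - 1))) (MulOpposite.op (-(x K m q * h K m q ^ (m - 1))))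
    (by rw [← MulOpposite.op_pow, ← pow_mul, mul_comm, pow_mul, h_pow, one_pow, MulOpposite.op_one])
    (by rw [← MulOpposite.op_pow, neg_pow, x_mul_h_pow_pow hm, mul_zero, MulOpposite.op_zero])
    (by
      rw [← MulOpposite.op_mul, ← MulOpposite.op_mul, ← MulOpposite.op_smul, mul_neg, neg_mul,
        ← mul_assoc, h_pow_mul_x hm, smul_mul_assoc, smul_neg])

variable [hm : NeZero m] [hq : Fact (IsPrimitiveRoot q m)]

noncomputable instance instBialgebra : Bialgebra K (TaftAlgebra K m q) :=
  .ofAlgHom (comulHom hq.out) (counitHom hm.out)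
    (by
      apply algHom_ext
      · simp [comulHom]
      · simp [comulHom, TensorProduct.add_tmul, TensorProduct.tmul_add, add_assoc,
          Algebra.TensorProduct.one_def])
    (by
      apply algHom_ext
      · simp [comulHom, counitHom]
      · simp [comulHom, counitHom])
    (by
      apply algHom_ext
      · simp [comulHom, counitHom]
      · simp [comulHom, counitHom])

@[simp] theorem comul_h : Coalgebra.comul (R := K) (h K m q) = h K m q ⊗ₜ h K m q :=
  lift_h ..

@[simp] theorem comul_x :
    Coalgebra.comul (R := K) (x K m q) = x K m q ⊗ₜ h K m q + 1 ⊗ₜ x K m q :=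
  lift_x ..

@[simp] theorem counit_h : Coalgebra.counit (R := K) (h K m q) = 1 := lift_h ..

@[simp] theorem counit_x : Coalgebra.counit (R := K) (x K m q) = 0 := lift_x ..

noncomputable instance instHopfAlgebraStruct : HopfAlgebraStruct K (TaftAlgebra K m q) where
  antipode := (MulOpposite.opLinearEquiv K).symm.toLinearMap ∘ₗ (antipodeHom hm.out).toLinearMap

open HopfAlgebraStruct

theorem antipode_mul (a b : TaftAlgebra K m q) :
    antipode K (a * b) = antipode K b * antipode K a := by
  simp [antipode]

theorem antipode_algebraMap (c : K) :
    antipode K (algebraMap K (TaftAlgebra K m q) c) = algebraMap K _ c := by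
  simp [antipode]

theorem antipode_one' : antipode K (1 : TaftAlgebra K m q) = 1 := by
  simpa using antipode_algebraMap (m := m) (q := q) (1 : K)

@[simp] theorem antipode_h : antipode K (h K m q) = h K m q ^ (m - 1) := by
  simp [antipode, antipodeHom]

@[simp] theorem antipode_x : antipode K (x K m q) = -(x K m q * h K m q ^ (m - 1)) := by
  simp [antipode, antipodeHom]

noncomputable instance instHopfAlgebra : HopfAlgebra K (TaftAlgebra K m q) where
  mul_antipode_rTensor_comul := by
    ext a
    simp only [LinearMap.comp_apply]
    induction a using TaftAlgebra.induction with
    | hc c =>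
      rw [Bialgebra.comul_algebraMap, Bialgebra.counit_algebraMap,
        Algebra.TensorProduct.algebraMap_apply]
      simp [antipode_algebraMap]
    | hh => simp [h_pow_mul_h hm.out]
    | hx => simp [mul_assoc, h_pow_mul_h hm.out, antipode_one']
    | hadd a b ha hb => simp only [map_add, ha, hb]
    | hmul a b ha hb =>
      rw [Bialgebra.comul_mul, Bialgebra.counit_mul]
      have ea := (Coalgebra.Repr.arbitrary K a).eq
      have eb := (Coalgebra.Repr.arbitrary K b).eq
      rw [← ea] at ha ⊢
      rw [← eb] at hb ⊢
      simp only [map_sum, LinearMap.rTensor_tmul, LinearMap.mul'_apply, Algebra.linearMap_apply,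
        Finset.sum_mul_sum, Algebra.TensorProduct.tmul_mul_tmul, antipode_mul, map_mul] at ha hb ⊢
      rw [Finset.sum_comm, ← hb, Finset.mul_sum]
      refine Finset.sum_congr rfl fun j _ => ?_
      rw [← mul_assoc, Algebra.commutes, ← ha, Finset.mul_sum, Finset.sum_mul]
      exact Finset.sum_congr rfl fun i _ => by simp only [mul_assoc]
  mul_antipode_lTensor_comul := by
    ext a
    simp only [LinearMap.comp_apply]
    induction a using TaftAlgebra.induction with
    | hc c =>
      rw [Bialgebra.comul_algebraMap, Bialgebra.counit_algebraMap,
        Algebra.TensorProduct.algebraMap_apply]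
      simp [antipode_one']
    | hh => simp [h_mul_h_pow hm.out]
    | hx => simp
    | hadd a b ha hb => simp only [map_add, ha, hb]
    | hmul a b ha hb =>
      rw [Bialgebra.comul_mul, Bialgebra.counit_mul]
      have ea := (Coalgebra.Repr.arbitrary K a).eq
      have eb := (Coalgebra.Repr.arbitrary K b).eq
      rw [← ea] at ha ⊢
      rw [← eb] at hb ⊢
      simp only [map_sum, LinearMap.lTensor_tmul, LinearMap.mul'_apply, Algebra.linearMap_apply,
        Finset.sum_mul_sum, Algebra.TensorProduct.tmul_mul_tmul, antipode_mul, map_mul] at ha hb ⊢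
      rw [← ha, Finset.sum_mul]
      refine Finset.sum_congr rfl fun i _ => ?_
      rw [mul_assoc, ← Algebra.commutes, ← hb, Finset.sum_mul, Finset.mul_sum]
      exact Finset.sum_congr rfl fun j _ => by simp only [mul_assoc]

end TaftAlgebra

end Taft

section Bicrossed

variable (K : Type*) [Field K] (A H : Type*) [Ring A] [HopfAlgebra K A] [Ring H] [HopfAlgebra K H]

/-- A matched pair `(A, H, ◁, ▷)` of Hopf algebras. -/
structure HopfMatchedPair where
  /-- the left action `▷ : H ⊗ A → A`, a coalgebra map -/
  left : H ⊗[K] A →ₗc[K] A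
  /-- the right action `◁ : H ⊗ A → H`, a coalgebra map -/
  right : H ⊗[K] A →ₗc[K] H
  /-- `1 ▷ a = a` -/
  one_left : ∀ a : A, left (1 ⊗ₜ a) = a
  /-- `(y z) ▷ a = y ▷ (z ▷ a)` -/
  mul_left : ∀ (y z : H) (a : A), left ((y * z) ⊗ₜ a) = left (y ⊗ₜ left (z ⊗ₜ a))
  /-- `y ◁ 1 = y` -/
  right_one : ∀ y : H, right (y ⊗ₜ 1) = y
  /-- `y ◁ (a b) = (y ◁ a) ◁ b` -/
  right_mul : ∀ (y : H) (a b : A), right (y ⊗ₜ (a * b)) = right (right (y ⊗ₜ a) ⊗ₜ b)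
  /-- `y ▷ 1 = ε(y) 1` -/
  left_one : ∀ y : H, left (y ⊗ₜ 1) = Coalgebra.counit (R := K) y • (1 : A)
  /-- `1 ◁ a = ε(a) 1` -/
  one_right : ∀ a : A, right (1 ⊗ₜ a) = Coalgebra.counit (R := K) a • (1 : H)
  /-- `y ▷ (a b) = (y₁ ▷ a₁) ((y₂ ◁ a₂) ▷ b)`, the comultiplication being that of `H ⊗ A` -/
  left_mul : ∀ (y : H) (a b : A), left (y ⊗ₜ (a * b)) =
    LinearMap.mul' K A (TensorProduct.map (left : H ⊗[K] A →ₗ[K] A)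
      ((left : H ⊗[K] A →ₗ[K] A) ∘ₗ (TensorProduct.mk K H A).flip b ∘ₗ
        (right : H ⊗[K] A →ₗ[K] H))
      (Coalgebra.comul (R := K) (y ⊗ₜ[K] a)))
  /-- `(y z) ◁ a = (y ◁ (z₁ ▷ a₁)) (z₂ ◁ a₂)` -/
  mul_right : ∀ (y z : H) (a : A), right ((y * z) ⊗ₜ a) =
    LinearMap.mul' K H (TensorProduct.map
      ((right : H ⊗[K] A →ₗ[K] H) ∘ₗ TensorProduct.mk K H A y ∘ₗ (left : H ⊗[K] A →ₗ[K] A))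
      (right : H ⊗[K] A →ₗ[K] H)
      (Coalgebra.comul (R := K) (z ⊗ₜ[K] a)))
  /-- `(y₁ ◁ a₁) ⊗ (y₂ ▷ a₂) = (y₂ ◁ a₂) ⊗ (y₁ ▷ a₁)` -/
  compat : ∀ (y : H) (a : A),
    TensorProduct.map (right : H ⊗[K] A →ₗ[K] H) (left : H ⊗[K] A →ₗ[K] A)
      (Coalgebra.comul (R := K) (y ⊗ₜ[K] a)) =
    TensorProduct.comm K A H
      (TensorProduct.map (left : H ⊗[K] A →ₗ[K] A) (right : H ⊗[K] A →ₗ[K] H)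
        (Coalgebra.comul (R := K) (y ⊗ₜ[K] a)))

/-- The data of a smash (semi-direct) product `A # H`: a left `H`-module algebra and
`H`-module coalgebra structure on `A` with `y₁ ⊗ (y₂ ▷ a) = y₂ ⊗ (y₁ ▷ a)`. -/
structure SmashAction where
  /-- the left action `▷ : H ⊗ A → A`, a coalgebra map -/
  left : H ⊗[K] A →ₗc[K] A
  /-- `1 ▷ a = a` -/
  one_left : ∀ a : A, left (1 ⊗ₜ a) = a
  /-- `(y z) ▷ a = y ▷ (z ▷ a)` -/
  mul_left : ∀ (y z : H) (a : A), left ((y * z) ⊗ₜ a) = left (y ⊗ₜ left (z ⊗ₜ a))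
  /-- `y ▷ 1 = ε(y) 1` -/
  left_one : ∀ y : H, left (y ⊗ₜ 1) = Coalgebra.counit (R := K) y • (1 : A)
  /-- `y ▷ (a b) = (y₁ ▷ a) (y₂ ▷ b)` -/
  left_mul : ∀ (y : H) (a b : A), left (y ⊗ₜ (a * b)) =
    LinearMap.mul' K A (TensorProduct.map
      ((left : H ⊗[K] A →ₗ[K] A) ∘ₗ (TensorProduct.mk K H A).flip a)
      ((left : H ⊗[K] A →ₗ[K] A) ∘ₗ (TensorProduct.mk K H A).flip b)
      (Coalgebra.comul (R := K) y))
  /-- `y₁ ⊗ (y₂ ▷ a) = y₂ ⊗ (y₁ ▷ a)` -/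
  compat : ∀ (y : H) (a : A),
    TensorProduct.map LinearMap.id
      ((left : H ⊗[K] A →ₗ[K] A) ∘ₗ (TensorProduct.mk K H A).flip a)
      (Coalgebra.comul (R := K) y) =
    TensorProduct.comm K A H (TensorProduct.map
      ((left : H ⊗[K] A →ₗ[K] A) ∘ₗ (TensorProduct.mk K H A).flip a) LinearMap.id
      (Coalgebra.comul (R := K) y))

variable {K A H}

/-- The right action is trivial: `y ◁ a = ε(a) y`. -/
def HopfMatchedPair.RightTrivial (P : HopfMatchedPair K A H) : Prop :=
  ∀ (y : H) (a : A), P.right (y ⊗ₜ a) = Coalgebra.counit (R := K) a • y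

/-- The smash product `A # H`: the tensor product coalgebra `A ⊗ H` with the multiplication
`(a # y) (b # z) = a (y₁ ▷ b) # y₂ z`. -/
def SmashProduct (_α : SmashAction K A H) : Type _ := A ⊗[K] H

namespace SmashProduct

open WithConv Coalgebra

variable (α : SmashAction K A H)

/-- `y ↦ y ▷ a` -/
noncomputable def actOn (a : A) : H →ₗ[K] A :=
  (α.left : H ⊗[K] A →ₗ[K] A) ∘ₗ (TensorProduct.mk K H A).flip a

@[simp] theorem actOn_apply (a : A) (y : H) : actOn α a y = α.left (y ⊗ₜ a) := rfl

/-- The left action as a representation of `H`. -/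
noncomputable def actHom : H →ₐ[K] Module.End K A :=
  AlgHom.ofLinearMap (TensorProduct.curry (α.left : H ⊗[K] A →ₗ[K] A))
    (by ext a; exact α.one_left a) (by intro y z; ext a; exact α.mul_left y z a)

@[simp] theorem actHom_apply (a : A) (y : H) : actHom α y a = α.left (y ⊗ₜ a) := rfl

/-- Left multiplication by `a # 1` on `A ⊗ H`. -/
noncomputable def lmulA (K A H : Type*) [Field K] [Ring A] [HopfAlgebra K A] [Ring H]
    [HopfAlgebra K H] : A →ₐ[K] Module.End K (A ⊗[K] H) :=
  (Module.endTensorEndAlgHom (R := K) (S := K) (A := K) (M := A) (N := H)).comp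
    (Algebra.TensorProduct.includeLeft.comp (Algebra.lmul K A))

@[simp] theorem lmulA_apply (a b : A) (z : H) : lmulA K A H a (b ⊗ₜ z) = (a * b) ⊗ₜ z := rfl

/-- Left multiplication by `1 # y` on `A ⊗ H`: `b ⊗ z ↦ (y₁ ▷ b) ⊗ y₂ z`. -/
noncomputable def lmulH : H →ₐ[K] Module.End K (A ⊗[K] H) :=
  (Module.endTensorEndAlgHom (R := K) (S := K) (A := K) (M := A) (N := H)).comp
    ((Algebra.TensorProduct.map (actHom α) (Algebra.lmul K H)).comp (Bialgebra.comulAlgHom K H))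

theorem lmulH_apply (y : H) (b : A) (z : H) {ι : Type*} (r : Repr K y ι) :
    lmulH α y (b ⊗ₜ z) = ∑ i ∈ r.index, α.left (r.left i ⊗ₜ b) ⊗ₜ (r.right i * z) := by
  simp [lmulH, ← r.eq, Module.endTensorEndAlgHom_apply]

/-- The multiplication of the smash product. -/
noncomputable def mulMap : A ⊗[K] H →ₗ[K] Module.End K (A ⊗[K] H) :=
  TensorProduct.lift ((LinearMap.mul K (Module.End K (A ⊗[K] H))).compl₁₂
    (lmulA K A H).toLinearMap (lmulH α).toLinearMap)

theorem mulMap_tmul (a : A) (y : H) : mulMap α (a ⊗ₜ y) = lmulA K A H a * lmulH α y := rfl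

theorem lmulH_mul_lmulA (y : H) (b : A) {ι : Type*} (r : Repr K y ι) :
    lmulH α y * lmulA K A H b =
      ∑ i ∈ r.index, lmulA K A H (α.left (r.left i ⊗ₜ b)) * lmulH α (r.right i) := by
  let U : WithConv (H →ₗ[K] Module.End K (A ⊗[K] H)) := toConv
    ((Module.endTensorEndAlgHom (R := K) (S := K) (A := K) (M := A) (N := H)).comp
    (Algebra.TensorProduct.includeLeft.comp (actHom α))).toLinearMap
  let V : WithConv (H →ₗ[K] Module.End K (A ⊗[K] H)) := toConv
    ((Module.endTensorEndAlgHom (R := K) (S := K) (A := K) (M := A) (N := H)).comp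
    (Algebra.TensorProduct.includeRight.comp (Algebra.lmul K H))).toLinearMap
  let P : WithConv (H →ₗ[K] Module.End K (A ⊗[K] H)) := toConv
    ((lmulA K A H).toLinearMap ∘ₗ actOn α b)
  let Ub : WithConv (H →ₗ[K] Module.End K (A ⊗[K] H)) := toConv
    (LinearMap.mulRight K (lmulA K A H b) ∘ₗ U.ofConv)
  have hU : ∀ (y : H) (c : A) (z : H), U y (c ⊗ₜ z) = α.left (y ⊗ₜ c) ⊗ₜ z := fun _ _ _ => rfl
  have hV : ∀ (y : H) (c : A) (z : H), V y (c ⊗ₜ z) = c ⊗ₜ (y * z) := fun _ _ _ => rfl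
  have hP : ∀ (y : H), P y = lmulA K A H (α.left (y ⊗ₜ b)) := fun _ => rfl
  have hUb' : ∀ (y : H), Ub y = U y * lmulA K A H b := fun _ => rfl
  have hUV : ∀ y, (U * V) y = lmulH α y := by
    intro y
    rw [(Repr.arbitrary K y).convMul_apply]
    ext c z
    simp only [LinearMap.sum_apply, TensorProduct.AlgebraTensorModule.curry_apply,
      LinearMap.restrictScalars_self, TensorProduct.curry_apply, Module.End.mul_apply, hU, hV]
    rw [lmulH_apply α y c z (Repr.arbitrary K y)]
  have hUb : Ub = P * U := by
    ext y c z
    rw [(Repr.arbitrary K y).convMul_apply]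
    simp only [LinearMap.sum_apply, TensorProduct.AlgebraTensorModule.curry_apply,
      LinearMap.restrictScalars_self, TensorProduct.curry_apply, Module.End.mul_apply, hU, hP,
      lmulA_apply, hUb']
    rw [α.left_mul, ← (Repr.arbitrary K y).eq]
    simp [TensorProduct.sum_tmul]
  have h1 : lmulH α y * lmulA K A H b = (Ub * V) y := by
    rw [← hUV, r.convMul_apply, r.convMul_apply, Finset.sum_mul]
    refine Finset.sum_congr rfl fun i _ => ?_
    rw [hUb', mul_assoc, mul_assoc]
    congr 1
    ext c z
    simp [hV]
  rw [h1, hUb, mul_assoc, r.convMul_apply]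
  simp only [hUV, hP]

theorem mulMap_mulMap (u v : A ⊗[K] H) :
    mulMap α (mulMap α u v) = mulMap α u * mulMap α v := by
  induction u with
  | zero => simp
  | add u u' h h' => simp only [map_add, LinearMap.add_apply, h, h', add_mul]
  | tmul a y =>
    induction v with
    | zero => simp
    | add v v' h h' => simp only [map_add, h, h', mul_add]
    | tmul b z =>
      rw [mulMap_tmul, mulMap_tmul, Module.End.mul_apply,
        lmulH_apply α y b z (Repr.arbitrary K y), mul_assoc (lmulA K A H a),
        ← mul_assoc (lmulH α y), lmulH_mul_lmulA α y b (Repr.arbitrary K y)]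
      simp only [map_sum, lmulA_apply, mulMap_tmul, map_mul, Finset.sum_mul, Finset.mul_sum,
        mul_assoc]

theorem mulMap_one (u : A ⊗[K] H) : mulMap α u (1 ⊗ₜ 1) = u := by
  induction u with
  | zero => simp
  | add u u' h h' => simp only [map_add, LinearMap.add_apply, h, h']
  | tmul a y =>
    rw [mulMap_tmul, Module.End.mul_apply, lmulH_apply α y 1 1 (Repr.arbitrary K y)]
    simp only [α.left_one, TensorProduct.smul_tmul, mul_one, ← TensorProduct.tmul_sum,
      sum_counit_smul, lmulA_apply]

theorem one_mulMap (u : A ⊗[K] H) : mulMap α (1 ⊗ₜ 1) u = u := by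
  rw [mulMap_tmul, map_one, map_one]; rfl

noncomputable instance : AddCommGroup (SmashProduct α) := inferInstanceAs (AddCommGroup (A ⊗[K] H))

noncomputable instance instModule : Module K (SmashProduct α) :=
  inferInstanceAs (Module K (A ⊗[K] H))

noncomputable instance instRing : Ring (SmashProduct α) where
  __ := (inferInstance : AddCommGroup (SmashProduct α))
  mul u v := mulMap α u v
  one := (1 : A) ⊗ₜ[K] (1 : H)
  mul_assoc u v w := congrArg (fun f : Module.End K (A ⊗[K] H) => f w) (mulMap_mulMap α u v)
  one_mul u := one_mulMap α u
  mul_one u := mulMap_one α u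
  left_distrib u v w := map_add (mulMap α u) v w
  right_distrib u v w := congrArg (fun f : Module.End K (A ⊗[K] H) => f w) (map_add (mulMap α) u v)
  zero_mul u := congrArg (fun f : Module.End K (A ⊗[K] H) => f u) (map_zero (mulMap α))
  mul_zero u := map_zero (mulMap α u)

noncomputable instance instAlgebra : Algebra K (SmashProduct α) :=
  Algebra.ofModule
    (fun c u v => congrArg (fun f : Module.End K (A ⊗[K] H) => f v) (map_smul (mulMap α) c u))
    (fun c u v => map_smul (mulMap α u) c v)

noncomputable instance instCoalgebra : Coalgebra K (SmashProduct α) :=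
  inferInstanceAs (Coalgebra K (A ⊗[K] H))


/-- `a # y` -/
noncomputable def tmul (a : A) (y : H) : SmashProduct α := a ⊗ₜ[K] y

@[elab_as_elim]
theorem induction {P : SmashProduct α → Prop} (h0 : P 0) (ht : ∀ a y, P (tmul α a y))
    (hadd : ∀ u v, P u → P v → P (u + v)) (u : SmashProduct α) : P u :=
  TensorProduct.induction_on (motive := P) u h0 ht hadd

/-- The multiplication in Sweedler notation. -/
theorem tmul_mul_tmul (a b : A) (y z : H) {ι : Type*} (r : Repr K y ι) :
    tmul α a y * tmul α b z =
      ∑ i ∈ r.index, tmul α (a * α.left (r.left i ⊗ₜ b)) (r.right i * z) := by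
  change (lmulA K A H a * lmulH α y) (b ⊗ₜ[K] z) = _
  rw [Module.End.mul_apply, lmulH_apply α y b z r, map_sum]
  rfl

/-- The embedding `a ↦ a # 1`. -/
noncomputable def inA : A →ₗ[K] SmashProduct α := (TensorProduct.mk K A H).flip 1

/-- The embedding `y ↦ 1 # y`. -/
noncomputable def inH : H →ₗ[K] SmashProduct α := TensorProduct.mk K A H 1

theorem inA_mul_tmul (a b : A) (z : H) : inA α a * tmul α b z = tmul α (a * b) z := by
  change (lmulA K A H a * lmulH α 1) (b ⊗ₜ[K] z) = _
  rw [map_one, mul_one]; rfl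

theorem tmul_eq (a : A) (y : H) : tmul α a y = inA α a * inH α y := by
  change _ = inA α a * tmul α 1 y
  rw [inA_mul_tmul, mul_one]

theorem tmul_mul_inH (a : A) (y z : H) : tmul α a y * inH α z = tmul α a (y * z) := by
  change tmul α a y * tmul α 1 z = _
  rw [tmul_mul_tmul α a 1 y z (Repr.arbitrary K y)]
  conv_rhs => rw [← sum_counit_smul (Repr.arbitrary K y)]
  simp only [α.left_one, tmul, mul_smul_comm, mul_one, TensorProduct.smul_tmul, Finset.sum_mul,
    TensorProduct.tmul_sum, smul_mul_assoc]
  rfl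

theorem inA_mul_inA (a b : A) : inA α a * inA α b = inA α (a * b) := inA_mul_tmul α a b 1

theorem inH_mul_inH (y z : H) : inH α y * inH α z = inH α (y * z) := tmul_mul_inH α 1 y z

theorem inA_one : inA α 1 = 1 := rfl

theorem inH_one : inH α 1 = 1 := rfl

theorem inH_mul_inA (y : H) (b : A) {ι : Type*} (r : Repr K y ι) :
    inH α y * inA α b = ∑ i ∈ r.index, inA α (α.left (r.left i ⊗ₜ b)) * inH α (r.right i) := by
  change tmul α 1 y * tmul α b 1 = _
  rw [tmul_mul_tmul α 1 b y 1 r]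
  simp only [one_mul, mul_one, tmul_eq]

theorem comul_tmul (a : A) (y : H) {ι κ : Type*} (r : Repr K a ι) (s : Repr K y κ) :
    comul (R := K) (tmul α a y) = ∑ i ∈ r.index, ∑ j ∈ s.index,
      tmul α (r.left i) (s.left j) ⊗ₜ[K] tmul α (r.right i) (s.right j) := by
  change comul (R := K) (a ⊗ₜ[K] y) = _
  rw [TensorProduct.comul_tmul, ← r.eq, ← s.eq, TensorProduct.sum_tmul, map_sum]
  refine Finset.sum_congr rfl fun i _ => ?_
  rw [TensorProduct.tmul_sum, map_sum]
  rfl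

theorem counit_tmul (a : A) (y : H) :
    counit (R := K) (tmul α a y) = counit (R := K) y * counit (R := K) a := rfl

/-- The representation of the comultiplication of `1`. -/
def reprOne (K A : Type*) [Field K] [Ring A] [HopfAlgebra K A] : Repr K (1 : A) Unit where
  index := {()}
  left _ := 1
  right _ := 1
  eq := by simp [Algebra.TensorProduct.one_def]

theorem comul_inA (a : A) {ι : Type*} (r : Repr K a ι) :
    comul (R := K) (inA α a) = ∑ i ∈ r.index, inA α (r.left i) ⊗ₜ[K] inA α (r.right i) := by
  refine (comul_tmul α a 1 r (reprOne K H)).trans ?_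
  simp [reprOne]
  rfl

theorem comul_inH (y : H) {ι : Type*} (r : Repr K y ι) :
    comul (R := K) (inH α y) = ∑ i ∈ r.index, inH α (r.left i) ⊗ₜ[K] inH α (r.right i) := by
  refine (comul_tmul α 1 y (reprOne K A) r).trans ?_
  simp [reprOne]
  rfl

theorem comul_inA_mul (a : A) (v : SmashProduct α) :
    comul (R := K) (inA α a * v) = comul (R := K) (inA α a) * comul (R := K) v := by
  induction v using SmashProduct.induction with
  | h0 => simp
  | hadd u v hu hv => simp only [mul_add, map_add, hu, hv]
  | ht b z =>
    rw [inA_mul_tmul, comul_tmul α (a * b) z ((Repr.arbitrary K a).mul (Repr.arbitrary K b))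
      (Repr.arbitrary K z), comul_inA α a (Repr.arbitrary K a),
      comul_tmul α b z (Repr.arbitrary K b) (Repr.arbitrary K z), Finset.sum_mul_sum]
    simp [Finset.mul_sum, inA_mul_tmul, Finset.sum_product]

theorem comul_mul_inH (z : H) (v : SmashProduct α) :
    comul (R := K) (v * inH α z) = comul (R := K) v * comul (R := K) (inH α z) := by
  induction v using SmashProduct.induction with
  | h0 => simp
  | hadd u v hu hv => simp only [add_mul, map_add, hu, hv]
  | ht b y =>
    rw [tmul_mul_inH, comul_tmul α b (y * z) (Repr.arbitrary K b)
      ((Repr.arbitrary K y).mul (Repr.arbitrary K z)), comul_inH α z (Repr.arbitrary K z),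
      comul_tmul α b y (Repr.arbitrary K b) (Repr.arbitrary K y), Finset.sum_mul]
    simp [Finset.sum_mul, Finset.mul_sum, tmul_mul_inH, Finset.sum_product]
    exact Finset.sum_congr rfl fun i _ => Finset.sum_comm

theorem comul_inH_mul_inA (y : H) (b : A) :
    comul (R := K) (inH α y * inA α b) =
      comul (R := K) (inH α y) * comul (R := K) (inA α b) := by
  let ry := Repr.arbitrary K y
  let rb := Repr.arbitrary K b
  let W := WithConv (H →ₗ[K] SmashProduct α ⊗[K] SmashProduct α)
  let E₁ : A → W := fun c => toConv ((TensorProduct.mk K _ _).flip 1 ∘ₗ inA α ∘ₗ actOn α c)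
  let E₂ : A → W := fun c => toConv (TensorProduct.mk K _ _ 1 ∘ₗ inA α ∘ₗ actOn α c)
  let F₁ : W := toConv ((TensorProduct.mk K _ _).flip 1 ∘ₗ inH α)
  let F₂ : W := toConv (TensorProduct.mk K _ _ 1 ∘ₗ inH α)
  have hE₁ : ∀ c z, E₁ c z = inA α (α.left (z ⊗ₜ c)) ⊗ₜ 1 := fun _ _ => rfl
  have hE₂ : ∀ c z, E₂ c z = 1 ⊗ₜ inA α (α.left (z ⊗ₜ c)) := fun _ _ => rfl
  have hF₁ : ∀ z, F₁ z = inH α z ⊗ₜ 1 := fun _ => rfl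
  have hF₂ : ∀ z, F₂ z = 1 ⊗ₜ inH α z := fun _ => rfl
  have hF : ∀ z, (F₁ * F₂) z = comul (R := K) (inH α z) := by
    intro z
    rw [(Repr.arbitrary K z).convMul_apply, comul_inH α z (Repr.arbitrary K z)]
    simp [hF₁, hF₂]
  have hE : ∀ z, ∑ j ∈ rb.index, (E₁ (rb.left j) * E₂ (rb.right j)) z =
      comul (R := K) (inA α (α.left (z ⊗ₜ b))) := by
    intro z
    let rz := Repr.arbitrary K z
    have h1 : comul (R := K) (α.left (z ⊗ₜ[K] b)) = ∑ j ∈ rb.index, ∑ i ∈ rz.index,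
        α.left (rz.left i ⊗ₜ rb.left j) ⊗ₜ[K] α.left (rz.right i ⊗ₜ rb.right j) := by
      rw [← CoalgHomClass.map_comp_comul_apply, TensorProduct.comul_tmul, ← rz.eq, ← rb.eq,
        TensorProduct.tmul_sum]
      simp only [TensorProduct.sum_tmul, map_sum]
      rfl
    have h2 : ∀ a : A, comul (R := K) (inA α a) =
        TensorProduct.map (inA α) (inA α) (comul (R := K) a) := by
      intro a
      rw [comul_inA α a (Repr.arbitrary K a), ← (Repr.arbitrary K a).eq]
      simp only [map_sum, TensorProduct.map_tmul]
    rw [h2, h1]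
    simp only [map_sum, TensorProduct.map_tmul]
    refine Finset.sum_congr rfl fun j _ => ?_
    rw [rz.convMul_apply]
    simp [hE₁, hE₂]
  have hc : ∀ c, E₂ c * F₁ = F₁ * E₂ c := by
    intro c
    refine WithConv.ext (LinearMap.ext fun z => ?_)
    change (E₂ c * F₁) z = (F₁ * E₂ c) z
    have h := congrArg (TensorProduct.map (inH α) (inA α)) (α.compat z c)
    rw [(Repr.arbitrary K z).convMul_apply, (Repr.arbitrary K z).convMul_apply]
    rw [← (Repr.arbitrary K z).eq] at h
    simp only [map_sum, TensorProduct.map_tmul, TensorProduct.comm_tmul, LinearMap.id_apply] at h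
    simp only [hE₂, hF₁, Algebra.TensorProduct.tmul_mul_tmul, one_mul, mul_one]
    exact h.symm
  have h12 : ∀ c z, (E₁ c * F₁) z = (inH α z * inA α c) ⊗ₜ 1 := by
    intro c z
    rw [(Repr.arbitrary K z).convMul_apply, inH_mul_inA α z c (Repr.arbitrary K z)]
    simp [hE₁, hF₁, TensorProduct.sum_tmul]
  have h34 : ∀ c z, (E₂ c * F₂) z = 1 ⊗ₜ (inH α z * inA α c) := by
    intro c z
    rw [(Repr.arbitrary K z).convMul_apply, inH_mul_inA α z c (Repr.arbitrary K z)]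
    simp [hE₂, hF₂, TensorProduct.tmul_sum]
  have hL : comul (R := K) (inH α y * inA α b) =
      ∑ j ∈ rb.index, ((E₁ (rb.left j) * E₂ (rb.right j)) * (F₁ * F₂)) y := by
    rw [inH_mul_inA α y b ry, map_sum]
    simp only [comul_inA_mul, ← hE, ← hF, ry.convMul_apply, Finset.sum_mul]
    exact Finset.sum_comm
  have hR : comul (R := K) (inH α y) * comul (R := K) (inA α b) =
      ∑ j ∈ rb.index, ((E₁ (rb.left j) * F₁) * (E₂ (rb.right j) * F₂)) y := by
    simp only [ry.convMul_apply, h12, h34]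
    rw [comul_inH α y ry, comul_inA α b rb, Finset.sum_mul_sum, Finset.sum_comm]
    simp
  rw [hL, hR]
  refine Finset.sum_congr rfl fun j _ => ?_
  rw [mul_assoc (E₁ _), ← mul_assoc (E₂ _), hc, mul_assoc F₁, ← mul_assoc (E₁ _)]

theorem comul_mul' (u v : SmashProduct α) :
    comul (R := K) (u * v) = comul (R := K) u * comul (R := K) v := by
  induction u using SmashProduct.induction with
  | h0 => simp
  | hadd u u' hu hu' => simp only [add_mul, map_add, hu, hu']
  | ht a y =>
    induction v using SmashProduct.induction with
    | h0 => simp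
    | hadd v v' hv hv' => simp only [mul_add, map_add, hv, hv']
    | ht b z =>
      have e : tmul α a y * tmul α b z = inA α a * ((inH α y * inA α b) * inH α z) := by
        simp only [tmul_eq, mul_assoc]
      rw [e, comul_inA_mul, comul_mul_inH, comul_inH_mul_inA, tmul_eq, tmul_eq, comul_inA_mul,
        comul_inA_mul]
      simp only [mul_assoc]

theorem counit_mul' (u v : SmashProduct α) :
    counit (R := K) (u * v) = counit (R := K) u * counit (R := K) v := by
  induction u using SmashProduct.induction with
  | h0 => simp
  | hadd u u' hu hu' => simp only [add_mul, map_add, hu, hu']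
  | ht a y =>
    induction v using SmashProduct.induction with
    | h0 => simp
    | hadd v v' hv hv' => simp only [mul_add, map_add, hv, hv']
    | ht b z =>
      have hl : ∀ w : H, counit (R := K) (α.left (w ⊗ₜ b)) =
          counit (R := K) b * counit (R := K) w := fun w =>
        (CoalgHomClass.counit_comp_apply α.left (w ⊗ₜ[K] b)).trans rfl
      have hy : ∑ i ∈ (Repr.arbitrary K y).index,
          counit (R := K) ((Repr.arbitrary K y).left i) *
            counit (R := K) ((Repr.arbitrary K y).right i) = counit (R := K) y := by
        have := congrArg (counit (R := K)) (sum_counit_smul (Repr.arbitrary K y))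
        simpa only [map_sum, map_smul, smul_eq_mul] using this
      rw [tmul_mul_tmul α a b y z (Repr.arbitrary K y), map_sum, counit_tmul, counit_tmul, ← hy]
      simp only [counit_tmul, Bialgebra.counit_mul, hl, Finset.sum_mul]
      exact Finset.sum_congr rfl fun i _ => by ring

noncomputable instance instBialgebra : Bialgebra K (SmashProduct α) :=
  Bialgebra.mk' K (SmashProduct α)
    ((counit_tmul α 1 1).trans (by simp))
    (counit_mul' α _ _)
    ((comul_tmul α 1 1 (reprOne K A) (reprOne K H)).trans (by simp [reprOne]; rfl))
    (comul_mul' α _ _)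

/-- The antipode `a # y ↦ (1 # S y) (S a # 1)`. -/
noncomputable def antipodeMap : SmashProduct α →ₗ[K] SmashProduct α :=
  TensorProduct.lift ((LinearMap.mul K (SmashProduct α)).flip.compl₁₂
    (inA α ∘ₗ HopfAlgebra.antipode K) (inH α ∘ₗ HopfAlgebra.antipode K))

theorem antipodeMap_tmul (a : A) (y : H) : antipodeMap α (tmul α a y) =
    inH α (HopfAlgebra.antipode K y) * inA α (HopfAlgebra.antipode K a) := rfl

theorem inA_algebraMap (c : K) : inA α (algebraMap K A c) = algebraMap K _ c := by
  rw [Algebra.algebraMap_eq_smul_one, map_smul, inA_one, ← Algebra.algebraMap_eq_smul_one]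

theorem inH_algebraMap (c : K) : inH α (algebraMap K H c) = algebraMap K _ c := by
  rw [Algebra.algebraMap_eq_smul_one, map_smul, inH_one, ← Algebra.algebraMap_eq_smul_one]

noncomputable instance instHopfAlgebra : HopfAlgebra K (SmashProduct α) where
  antipode := antipodeMap α
  mul_antipode_rTensor_comul := by
    refine LinearMap.ext fun u => ?_
    simp only [LinearMap.comp_apply]
    induction u using SmashProduct.induction with
    | h0 => simp
    | hadd u v hu hv => simp only [map_add, hu, hv]
    | ht a y =>
      rw [comul_tmul α a y (Repr.arbitrary K a) (Repr.arbitrary K y), counit_tmul]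
      have ha := HopfAlgebra.sum_antipode_mul_eq_algebraMap_counit (Repr.arbitrary K a)
      have hy := HopfAlgebra.sum_antipode_mul_eq_algebraMap_counit (Repr.arbitrary K y)
      replace ha := congrArg (inA α) ha
      replace hy := congrArg (inH α) hy
      rw [inA_algebraMap] at ha
      rw [inH_algebraMap] at hy
      simp only [map_sum, ← inA_mul_inA, ← inH_mul_inH] at ha hy
      simp only [map_sum, LinearMap.rTensor_tmul, LinearMap.mul'_apply, antipodeMap_tmul,
        Algebra.linearMap_apply, map_mul]
      rw [Finset.sum_comm, ← hy, Finset.sum_mul]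
      refine Finset.sum_congr rfl fun j _ => ?_
      rw [mul_assoc, ← Algebra.commutes, ← ha, Finset.sum_mul, Finset.mul_sum]
      exact Finset.sum_congr rfl fun i _ => by simp only [tmul_eq, mul_assoc]
  mul_antipode_lTensor_comul := by
    refine LinearMap.ext fun u => ?_
    simp only [LinearMap.comp_apply]
    induction u using SmashProduct.induction with
    | h0 => simp
    | hadd u v hu hv => simp only [map_add, hu, hv]
    | ht a y =>
      rw [comul_tmul α a y (Repr.arbitrary K a) (Repr.arbitrary K y), counit_tmul]
      have ha := HopfAlgebra.sum_mul_antipode_eq_algebraMap_counit (Repr.arbitrary K a)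
      have hy := HopfAlgebra.sum_mul_antipode_eq_algebraMap_counit (Repr.arbitrary K y)
      replace ha := congrArg (inA α) ha
      replace hy := congrArg (inH α) hy
      rw [inA_algebraMap] at ha
      rw [inH_algebraMap] at hy
      simp only [map_sum, ← inA_mul_inA, ← inH_mul_inH] at ha hy
      simp only [map_sum, LinearMap.lTensor_tmul, LinearMap.mul'_apply, antipodeMap_tmul,
        Algebra.linearMap_apply, map_mul]
      rw [← ha, Finset.mul_sum]
      refine Finset.sum_congr rfl fun i _ => ?_
      rw [← mul_assoc, Algebra.commutes, mul_assoc, ← hy, Finset.sum_mul, Finset.mul_sum]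
      exact Finset.sum_congr rfl fun j _ => by simp only [tmul_eq, mul_assoc]

end SmashProduct

/-- `E` factorizes through `A` and `H`: there are injective Hopf algebra maps `i : A → E` and
`j : H → E` such that `A ⊗ H → E`, `a ⊗ y ↦ i a * j y`, is bijective. -/
def FactorizesThrough (K E A H : Type*) [Field K] [Ring E] [HopfAlgebra K E] [Ring A]
    [HopfAlgebra K A] [Ring H] [HopfAlgebra K H] : Prop :=
  ∃ (i : A →ₐc[K] E) (j : H →ₐc[K] E), Function.Injective i ∧ Function.Injective j ∧
    Function.Bijective
      (LinearMap.mul' K E ∘ₗ TensorProduct.map (i : A →ₗ[K] E) (j : H →ₗ[K] E))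

end Bicrossed

/-!
The Taft algebra is generated by a group-like element `h` and an element `x` with
`Δ x = x ⊗ h + 1 ⊗ x`. The whole argument rests on the linear independence of `x` and `1 - h`,
read off from a two-dimensional representation
(`TaftAlgebra.linearIndependent_x_one_sub_h`). As a consequence an equality of tensors
`w ⊗ f x = y ⊗ f (1 - h)` with `f` linear and injective forces `w = 0` and `y = 0`
(`TaftAlgebra.eq_zero_of_tmul_map_x_eq`).

In a matched pair, the compatibility condition at `g ⊗ x`, for `g` in the group, is the equality
`(g - g ◁ h) ⊗ (g ▷ x) = (g ◁ x) ⊗ (g ▷ (1 - h))`. Since `g ▷ ·` is injective, `g ◁ h = g` and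
`g ◁ x = 0`; as `h` and `x` generate the Taft algebra, the right action is trivial.

In a factorization `E = i A * j K[G]`, the projection `p : E → K[G]`, `i a * j y ↦ ε(a) y`, is a
coalgebra map, and since group-like elements are cocommutative the left and right coactions of
`K[G]` on `E` obtained from `p` agree. Their equality on `j g * i x` is an identity of the same
shape, so `p (j g * i h) = g` and `p (j g * i x) = 0`. Hence `j g * i h` and `j g * i x` are
homogeneous of degree `g` for the `G`-grading `E = ⨁ i A * j g`, which means that `j g` normalizes
`i A` (`GroupFactorization.exists_j_mul_eq`). Conjugation then is an action of `G` on `A` by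
bialgebra automorphisms, and `E` is the smash product for this action
(`GroupFactorization.exists_smashProduct_equiv`).
-/

section

open Coalgebra MonoidAlgebra

/-! ### Elementary tensors and the elements `x` and `1 - h` -/

theorem eq_zero_of_tmul_eq_tmul {K V W : Type*} [Field K] [AddCommGroup V] [Module K V]
    [AddCommGroup W] [Module K W] {w y : W} {u v : V} (hu : u ∉ Submodule.span K {v})
    (huv : w ⊗ₜ[K] u = y ⊗ₜ[K] v) : w = 0 := by
  obtain ⟨f, hfu, hfv⟩ := Submodule.exists_le_ker_of_notMem hu
  have hv : f v = 0 := hfv (Submodule.mem_span_singleton_self v)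
  have h := congrArg (fun t => TensorProduct.rid K W (f.lTensor W t)) huv
  simpa [hv, hfu] using h

namespace TaftAlgebra

section
variable {K : Type*} [Field K] {m : ℕ} {q : K}

/-- The representation `h ↦ diag(1, q)`, `x ↦ E₀₁` on `K²` is compatible with the relations since
`2 ≤ m`, and the images of `x` and `1 - h` are linearly independent since `q ≠ 1`. -/
theorem linearIndependent_x_one_sub_h [Nat.AtLeastTwo m] (hq : IsPrimitiveRoot q m) :
    LinearIndependent K ![x K m q, 1 - h K m q] := by
  have hm : 2 ≤ m := Nat.AtLeastTwo.prop
  let D : Matrix (Fin 2) (Fin 2) K := !![1, 0; 0, q]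
  let N : Matrix (Fin 2) (Fin 2) K := !![0, 1; 0, 0]
  have hD : D ^ m = 1 := by
    have : D = Matrix.diagonal ![1, q] := by ext i j; fin_cases i <;> fin_cases j <;> simp [D]
    rw [this, Matrix.diagonal_pow, ← Matrix.diagonal_one]
    congr 1
    ext i
    fin_cases i <;> simp [hq.pow_eq_one]
  have hN : N ^ m = 0 := by
    refine pow_eq_zero_of_le hm ?_
    rw [pow_two]
    ext i j; fin_cases i <;> fin_cases j <;> simp [N]
  have hND : N * D = q • (D * N) := by
    ext i j; fin_cases i <;> fin_cases j <;> simp [N, D]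
  have hq1 : 1 - q ≠ 0 := sub_ne_zero.2 (hq.ne_one (by omega)).symm
  rw [LinearIndependent.pair_iff]
  intro s t hst
  have h := congrArg (lift D N hD hN hND) hst
  simp only [map_add, map_smul, map_sub, map_one, lift_h, lift_x, map_zero] at h
  have h01 := congrFun (congrFun h 0) 1
  have h11 := congrFun (congrFun h 1) 1
  simp [D, N] at h01 h11
  exact ⟨h01, h11.resolve_right hq1⟩

/-- Both the compatibility condition of a matched pair and the comparison of the two coactions in a
factorization have this shape. -/
theorem eq_zero_of_tmul_map_x_eq [Nat.AtLeastTwo m] (hq : IsPrimitiveRoot q m) {V W : Type*}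
    [AddCommGroup V] [Module K V] [AddCommGroup W] [Module K W] {f : TaftAlgebra K m q →ₗ[K] V}
    (hf : Function.Injective f) {w y : W}
    (hwy : w ⊗ₜ[K] f (x K m q) = y ⊗ₜ[K] f (1 - h K m q)) : w = 0 ∧ y = 0 := by
  have hli := (linearIndependent_x_one_sub_h hq).map' f (LinearMap.ker_eq_bot.2 hf)
  have hli' : ∀ s t : K, s • f (x K m q) + t • f (1 - h K m q) = 0 → s = 0 ∧ t = 0 := by
    rw [← LinearIndependent.pair_iff]
    convert hli using 1
    ext i; fin_cases i <;> rfl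
  constructor
  · refine eq_zero_of_tmul_eq_tmul (fun hmem => ?_) hwy
    obtain ⟨c, hc⟩ := Submodule.mem_span_singleton.1 hmem
    exact one_ne_zero (hli' 1 (-c) (by rw [one_smul, neg_smul, hc, add_neg_cancel])).1
  · refine eq_zero_of_tmul_eq_tmul (fun hmem => ?_) hwy.symm
    obtain ⟨c, hc⟩ := Submodule.mem_span_singleton.1 hmem
    exact one_ne_zero (hli' (-c) 1 (by rw [one_smul, neg_smul, hc, neg_add_cancel])).2

theorem mem_of_h_mem_of_x_mem (B : Subalgebra K (TaftAlgebra K m q)) (hh : h K m q ∈ B)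
    (hx : x K m q ∈ B) (a : TaftAlgebra K m q) : a ∈ B := by
  induction a using TaftAlgebra.induction with
  | hc c => exact B.algebraMap_mem c
  | hh => exact hh
  | hx => exact hx
  | hadd a b ha hb => exact B.add_mem ha hb
  | hmul a b ha hb => exact B.mul_mem ha hb

end

end TaftAlgebra

/-! ### Matched pairs with a group algebra -/

namespace HopfMatchedPair

open TaftAlgebra

variable {K : Type*} [Field K] {m : ℕ} [Nat.AtLeastTwo m] {q : K}
    [hq : Fact (IsPrimitiveRoot q m)] {G : Type*} [Group G]
    (P : HopfMatchedPair K (TaftAlgebra K m q) (MonoidAlgebra K G))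

theorem left_single_injective (g : G) :
    Function.Injective (fun a => P.left (single g 1 ⊗ₜ a)) := by
  refine Function.LeftInverse.injective (g := fun a => P.left (single g⁻¹ 1 ⊗ₜ a)) fun a => ?_
  change P.left (_ ⊗ₜ P.left (_ ⊗ₜ a)) = a
  rw [← P.mul_left, single_mul_single, inv_mul_cancel, one_mul, ← one_def, P.one_left]

/-- The compatibility condition at `g ⊗ x` reads
`(g - g ◁ h) ⊗ (g ▷ x) = (g ◁ x) ⊗ (g ▷ (1 - h))`, so both sides vanish. -/
theorem right_single_h_and_x (g : G) :
    P.right (single g 1 ⊗ₜ h K m q) = single g 1 ∧ P.right (single g 1 ⊗ₜ x K m q) = 0 := by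
  have hc := P.compat (single g 1) (x K m q)
  let f : TaftAlgebra K m q →ₗ[K] TaftAlgebra K m q :=
    (P.left : MonoidAlgebra K G ⊗[K] TaftAlgebra K m q →ₗ[K] TaftAlgebra K m q) ∘ₗ
      TensorProduct.mk K _ _ (single g 1)
  have hf : ∀ a, f a = P.left (single g 1 ⊗ₜ a) := fun _ => rfl
  have hcom : comul (R := K) (single g (1 : K) ⊗ₜ[K] x K m q) =
      (single g 1 ⊗ₜ x K m q) ⊗ₜ (single g 1 ⊗ₜ h K m q) +
        (single g 1 ⊗ₜ 1) ⊗ₜ (single g 1 ⊗ₜ x K m q) := by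
    rw [TensorProduct.comul_tmul, comul_x]
    simp [TensorProduct.tmul_add]
  rw [hcom] at hc
  simp only [map_add, TensorProduct.map_tmul, TensorProduct.comm_tmul, LinearMap.coe_coe,
    P.right_one, ← hf] at hc
  have key : (single g 1 - P.right (single g 1 ⊗ₜ h K m q)) ⊗ₜ[K] f (x K m q) =
      P.right (single g 1 ⊗ₜ x K m q) ⊗ₜ[K] f (1 - h K m q) := by
    rw [map_sub, TensorProduct.sub_tmul, TensorProduct.tmul_sub, sub_eq_sub_iff_add_eq_add,
      add_comm, hc, add_comm]
  obtain ⟨h1, h2⟩ := eq_zero_of_tmul_map_x_eq hq.out (P.left_single_injective g) key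
  exact ⟨(sub_eq_zero.1 h1).symm, h2⟩

/-- By `right_mul`, it suffices that `· ◁ h` and `· ◁ x` are trivial on group elements. -/
theorem rightTrivial_of_taft : P.RightTrivial := by
  have single_h (g : G) := (P.right_single_h_and_x g).1
  have single_x (g : G) := (P.right_single_h_and_x g).2
  intro y a
  induction y using MonoidAlgebra.induction_on with
  | add y z hy hz => rw [TensorProduct.add_tmul, map_add, hy, hz, smul_add]
  | smul c y hy => rw [← TensorProduct.smul_tmul', map_smul, hy, smul_comm]
  | of g =>
    rw [of_apply]
    induction a using TaftAlgebra.induction with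
    | hc c =>
      rw [Algebra.algebraMap_eq_smul_one, TensorProduct.tmul_smul, map_smul, P.right_one]
      simp
    | hh => rw [single_h, counit_h, one_smul]
    | hx => rw [single_x, counit_x, zero_smul]
    | hadd a b ha hb => rw [TensorProduct.tmul_add, map_add, ha, hb, map_add, add_smul]
    | hmul a b ha hb =>
      rw [P.right_mul, ha, ← TensorProduct.smul_tmul', map_smul, hb, smul_smul, Bialgebra.counit_mul]

end HopfMatchedPair

/-! ### Smash products with a group algebra -/

namespace SmashAction

variable {K : Type*} [Field K] {A : Type*} [Ring A] [HopfAlgebra K A] {G : Type*} [Group G]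

/-- The linear map `K[G] ⊗ A → A`, `g ⊗ a ↦ φ g a`. -/
noncomputable def leftMap (φ : G →* (A →ₐc[K] A)) : MonoidAlgebra K G ⊗[K] A →ₗ[K] A :=
  TensorProduct.lift (MonoidAlgebra.lift K (Module.End K A) G
    { toFun := fun g => (φ g : A →ₗ[K] A)
      map_one' := by ext a; simp
      map_mul' := fun g k => by ext a; simp }).toLinearMap

@[simp] theorem leftMap_single (φ : G →* (A →ₐc[K] A)) (g : G) (c : K) (a : A) :
    leftMap φ (single g c ⊗ₜ a) = c • φ g a := by
  simp [leftMap]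

/-- An action of a group `G` on a Hopf algebra by bialgebra endomorphisms, extended linearly to
`K[G]`, is smash product data: group-like elements are cocommutative, so the compatibility condition
is automatic. -/
noncomputable def ofMonoidHom (φ : G →* (A →ₐc[K] A)) : SmashAction K A (MonoidAlgebra K G) where
  left :=
    { leftMap φ with
      counit_comp := by
        ext g a
        simp
      map_comp_comul := by
        ext g a
        have := CoalgHomClass.map_comp_comul_apply (φ g) a
        simp [TensorProduct.comul_tmul, ← this, ← (Repr.arbitrary K a).eq, TensorProduct.tmul_sum] }
  one_left a := by
    change leftMap φ (1 ⊗ₜ a) = a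
    simp [one_def]
  mul_left y z a := by
    change leftMap φ _ = leftMap φ (_ ⊗ₜ leftMap φ _)
    simp [leftMap]
  left_one y := by
    change leftMap φ _ = _
    induction y using MonoidAlgebra.induction_linear with
    | zero => simp
    | add y z hy hz => simp [TensorProduct.add_tmul, add_smul, hy, hz]
    | single g c => simp
  left_mul y a b := by
    change leftMap φ _ = LinearMap.mul' K A (TensorProduct.map
      (leftMap φ ∘ₗ (TensorProduct.mk K _ A).flip a) (leftMap φ ∘ₗ (TensorProduct.mk K _ A).flip b)
      (comul (R := K) y))
    induction y using MonoidAlgebra.induction_linear with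
    | zero => simp
    | add y z hy hz => simp [TensorProduct.add_tmul, hy, hz]
    | single g c => simp
  compat y a := by
    change TensorProduct.map LinearMap.id (leftMap φ ∘ₗ (TensorProduct.mk K _ A).flip a)
      (comul (R := K) y) = TensorProduct.comm K A _ (TensorProduct.map
      (leftMap φ ∘ₗ (TensorProduct.mk K _ A).flip a) LinearMap.id (comul (R := K) y))
    induction y using MonoidAlgebra.induction_linear with
    | zero => simp
    | add y z hy hz => simp [hy, hz]
    | single g c => simp [TensorProduct.smul_tmul']

theorem ofMonoidHom_left_single (φ : G →* (A →ₐc[K] A)) (g : G) (a : A) :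
    (ofMonoidHom φ).left (single g 1 ⊗ₜ a) = φ g a := by
  change leftMap φ _ = _
  simp

end SmashAction

/-! ### Factorizations through a group algebra -/

namespace GroupFactorization

variable {K : Type*} [Field K] {E : Type*} [Ring E] [HopfAlgebra K E] {A : Type*} [Ring A]
  [HopfAlgebra K A] {G : Type*} [Group G] (i : A →ₐc[K] E) (j : MonoidAlgebra K G →ₐc[K] E)

/-- The coalgebra map `A ⊗ K[G] → E`, `a ⊗ y ↦ i a * j y`. -/
noncomputable def mulMap : A ⊗[K] MonoidAlgebra K G →ₗc[K] E :=
  (Bialgebra.mulCoalgHom K E).comp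
    (Coalgebra.TensorProduct.map (i : A →ₗc[K] E) (j : MonoidAlgebra K G →ₗc[K] E))

@[simp] theorem mulMap_tmul (a : A) (y : MonoidAlgebra K G) : mulMap i j (a ⊗ₜ y) = i a * j y := rfl

theorem j_single_mul (g k : G) : j (single g 1) * j (single k 1) = j (single (g * k) 1) := by
  rw [← map_mul, single_mul_single, one_mul]

theorem j_single_mul_inv (g : G) : j (single g 1) * j (single g⁻¹ 1) = 1 := by
  rw [j_single_mul, mul_inv_cancel, ← one_def, map_one]

theorem j_single_inv_mul (g : G) : j (single g⁻¹ 1) * j (single g 1) = 1 := by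
  rw [j_single_mul, inv_mul_cancel, ← one_def, map_one]

theorem comul_j_single (g : G) :
    comul (R := K) (j (single g 1)) = j (single g 1) ⊗ₜ j (single g 1) := by
  rw [← CoalgHomClass.map_comp_comul_apply]
  simp

section Normal

variable {i j}

/-- If every `j g` normalizes `i A`, then `G` acts on `A` by conjugation in `E`. -/
theorem exists_monoidHom (hi : Function.Injective i)
    (hn : ∀ (g : G) (a : A), ∃ b : A, j (single g 1) * i a = i b * j (single g 1)) :
    ∃ φ : G →* (A →ₐc[K] A), ∀ g a, j (single g 1) * i a = i (φ g a) * j (single g 1) := by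
  choose f hf using hn
  -- `f g a` is determined by `i (f g a) * j g`, so its algebraic properties can be checked in `E`.
  have cancel {g : G} {a b : A} (hab : i a * j (single g 1) = i b * j (single g 1)) : a = b := by
    have h := congrArg (· * j (single g⁻¹ 1)) hab
    simp only [mul_assoc, j_single_mul_inv, mul_one] at h
    exact hi h
  have hconj (g : G) (a : A) : i (f g a) = j (single g 1) * i a * j (single g⁻¹ 1) := by
    rw [hf, mul_assoc, j_single_mul_inv, mul_one]
  let F (g : G) : A →ₐ[K] A := AlgHom.ofLinearMap
    { toFun := f g
      map_add' := fun a b => cancel (g := g) (by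
        rw [← hf, map_add, map_add, add_mul, mul_add, hf, hf])
      map_smul' := fun c a => cancel (g := g) (by
        rw [← hf, RingHom.id_apply, map_smul, map_smul, smul_mul_assoc, mul_smul_comm, hf]) }
    (cancel (g := g) (by
      change i (f g 1) * _ = _
      rw [← hf, map_one, one_mul, mul_one]))
    (fun a b => cancel (g := g) (by
      change i (f g (a * b)) * _ = i (f g a * f g b) * _
      rw [← hf, map_mul, map_mul, mul_assoc, ← hf, ← mul_assoc, hf, mul_assoc]))
  have hF (g : G) (a : A) : F g a = f g a := rfl
  have hjc (g : G) : counit (R := K) (j (single g 1)) = 1 := by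
    rw [CoalgHomClass.counit_comp_apply]
    simp
  -- Comultiplicativity is checked in `E ⊗ E`, into which `A ⊗ A` embeds.
  have hcomul (g : G) (a : A) :
      TensorProduct.map (F g).toLinearMap (F g).toLinearMap (comul (R := K) a) =
        comul (R := K) (F g a) := by
    refine TensorProduct.map_injective_of_flat_flat (i : A →ₗ[K] E) (i : A →ₗ[K] E) hi hi ?_
    have h1 := CoalgHomClass.map_comp_comul_apply i (F g a)
    have h2 := CoalgHomClass.map_comp_comul_apply i a
    refine Eq.trans ?_ h1.symm
    rw [hF, hconj, Bialgebra.comul_mul, Bialgebra.comul_mul, comul_j_single, comul_j_single, ← h2,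
      ← (Repr.arbitrary K a).eq]
    simp [Finset.mul_sum, Finset.sum_mul, hF, hconj]
  have hcounit (g : G) (a : A) : counit (R := K) (F g a) = counit (R := K) a := by
    rw [← CoalgHomClass.counit_comp_apply i, hF, hconj, Bialgebra.counit_mul, Bialgebra.counit_mul,
      hjc, hjc, one_mul, mul_one, CoalgHomClass.counit_comp_apply]
  let Φ (g : G) : A →ₐc[K] A := BialgHom.ofAlgHom (F g) (AlgHom.ext (hcounit g))
    (AlgHom.ext (hcomul g))
  have hΦ (g : G) (a : A) : Φ g a = f g a := rfl
  refine ⟨{ toFun := Φ, map_one' := ?_, map_mul' := fun g k => ?_ }, hf⟩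
  · ext a
    refine cancel (g := 1) ?_
    rw [hΦ, ← hf, ← one_def, map_one, one_mul, mul_one]
    rfl
  · ext a
    refine cancel (g := g * k) ?_
    change i (f (g * k) a) * _ = i (f g (f k a)) * _
    rw [← hf, ← j_single_mul, mul_assoc, hf, ← mul_assoc, hf, mul_assoc]

variable (i j) in
/-- The linear map `a # y ↦ i a * j y` on the smash product. -/
noncomputable def smashMap (φ : G →* (A →ₐc[K] A)) :
    SmashProduct (SmashAction.ofMonoidHom φ) →ₗ[K] E :=
  (mulMap i j : A ⊗[K] MonoidAlgebra K G →ₗ[K] E)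

theorem smashMap_tmul (φ : G →* (A →ₐc[K] A)) (a : A) (y : MonoidAlgebra K G) :
    smashMap i j φ (SmashProduct.tmul _ a y) = i a * j y := rfl

theorem smashMap_mul {φ : G →* (A →ₐc[K] A)}
    (hφ : ∀ g a, j (single g 1) * i a = i (φ g a) * j (single g 1))
    (u v : SmashProduct (SmashAction.ofMonoidHom φ)) :
    smashMap i j φ (u * v) = smashMap i j φ u * smashMap i j φ v := by
  induction u using SmashProduct.induction with
  | h0 => simp
  | hadd u u' hu hu' => simp only [add_mul, map_add, hu, hu']
  | ht a y =>
    induction v using SmashProduct.induction with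
    | h0 => simp
    | hadd v v' hv hv' => simp only [mul_add, map_add, hv, hv']
    | ht b z =>
      induction y using MonoidAlgebra.induction_linear with
      | zero =>
        have : SmashProduct.tmul (SmashAction.ofMonoidHom φ) a 0 = 0 := TensorProduct.tmul_zero _ a
        simp [this]
      | add y y' hy hy' =>
        have : SmashProduct.tmul (SmashAction.ofMonoidHom φ) a (y + y') =
          SmashProduct.tmul _ a y + SmashProduct.tmul _ a y' := TensorProduct.tmul_add a y y'
        simp only [this, add_mul, map_add, hy, hy']
      | single g c =>
        let r : Repr K (single g c : MonoidAlgebra K G) Unit :=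
          { index := {()}, left := fun _ => single g 1, right := fun _ => single g c, eq := by simp }
        have hc : (single g c : MonoidAlgebra K G) = single g 1 * algebraMap K _ c := by simp
        rw [SmashProduct.tmul_mul_tmul _ a b _ z r]
        simp only [r, Finset.sum_singleton, smashMap_tmul, SmashAction.ofMonoidHom_left_single,
          map_mul, hc]
        rw [mul_assoc (i a), mul_assoc (j _), ← mul_assoc (i (φ g b)), ← hφ, mul_assoc (i a),
          mul_assoc (j _), mul_assoc (j _), AlgHomClass.commutes, Algebra.left_comm]

/-- A factorization in which every `j g` normalizes `i A` is a smash product. -/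
theorem exists_smashProduct_equiv (hi : Function.Injective i)
    (hb : Function.Bijective (mulMap i j))
    (hn : ∀ (g : G) (a : A), ∃ b : A, j (single g 1) * i a = i b * j (single g 1)) :
    ∃ α : SmashAction K A (MonoidAlgebra K G), Nonempty (E ≃ₐc[K] SmashProduct α) := by
  obtain ⟨φ, hφ⟩ := exists_monoidHom hi hn
  let u : SmashProduct (SmashAction.ofMonoidHom φ) →ₐc[K] E :=
    BialgHom.ofAlgHom (AlgHom.ofLinearMap (smashMap i j φ)
      ((smashMap_tmul φ 1 1).trans (by rw [map_one, map_one, one_mul])) (smashMap_mul hφ))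
      (AlgHom.ext (LinearMap.congr_fun (mulMap i j).counit_comp))
      (AlgHom.ext (LinearMap.congr_fun (mulMap i j).map_comp_comul))
  exact ⟨_, ⟨(BialgEquiv.ofBijective u hb).symm⟩⟩

end Normal

section Coaction

variable {i j} (hb : Function.Bijective (mulMap i j))

/-- The coalgebra projection `E → K[G]`, `i a * j y ↦ ε(a) y`, of a factorization. -/
noncomputable def proj : E →ₗc[K] MonoidAlgebra K G :=
  ((Coalgebra.TensorProduct.lid K (MonoidAlgebra K G) : _ →ₗc[K] _).comp
    (Coalgebra.TensorProduct.map (counitCoalgHom K A) (CoalgHom.id K (MonoidAlgebra K G)))).comp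
    ((CoalgEquiv.ofBijective hb).symm : E →ₗc[K] A ⊗[K] MonoidAlgebra K G)

theorem proj_mul (a : A) (y : MonoidAlgebra K G) :
    proj hb (i a * j y) = counit (R := K) a • y := by
  have : (CoalgEquiv.ofBijective hb).symm (i a * j y) = a ⊗ₜ[K] y :=
    (CoalgEquiv.ofBijective hb).symm_apply_apply (a ⊗ₜ[K] y)
  simp [proj, this]

theorem proj_j (y : MonoidAlgebra K G) : proj hb (j y) = y := by
  simpa using proj_mul hb 1 y

theorem comul_mul_j_single (a : A) (g : G) : comul (R := K) (i a * j (single g 1)) =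
    ∑ k ∈ (Repr.arbitrary K a).index, (i ((Repr.arbitrary K a).left k) * j (single g 1)) ⊗ₜ[K]
      (i ((Repr.arbitrary K a).right k) * j (single g 1)) := by
  rw [Bialgebra.comul_mul, ← CoalgHomClass.map_comp_comul_apply i,
    ← CoalgHomClass.map_comp_comul_apply j, ← (Repr.arbitrary K a).eq]
  simp [Finset.sum_mul]

/-- The right coaction of `K[G]` on `E` is the `G`-grading `E = ⨁ i A * j g`. -/
theorem lTensor_proj_comul (a : A) (g : G) :
    (proj hb : E →ₗ[K] MonoidAlgebra K G).lTensor E (comul (R := K) (i a * j (single g 1))) =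
      (i a * j (single g 1)) ⊗ₜ single g 1 := by
  have h : ∑ k ∈ (Repr.arbitrary K a).index,
      counit (R := K) ((Repr.arbitrary K a).right k) • (Repr.arbitrary K a).left k = a := by
    simpa only [map_sum, TensorProduct.rid_tmul, one_smul] using
      congrArg (TensorProduct.rid K A) (sum_tmul_counit_eq (Repr.arbitrary K a))
  conv_rhs => rw [← h]
  rw [comul_mul_j_single, map_sum]
  simp only [LinearMap.lTensor_tmul, LinearMap.coe_coe, proj_mul, map_sum, map_smul,
    Finset.sum_mul, smul_mul_assoc, TensorProduct.sum_tmul, TensorProduct.smul_tmul]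

theorem rTensor_proj_comul (a : A) (g : G) :
    (proj hb : E →ₗ[K] MonoidAlgebra K G).rTensor E (comul (R := K) (i a * j (single g 1))) =
      single g 1 ⊗ₜ (i a * j (single g 1)) := by
  conv_rhs => rw [← sum_counit_smul (R := K) (Repr.arbitrary K a)]
  rw [comul_mul_j_single, map_sum]
  simp only [LinearMap.rTensor_tmul, LinearMap.coe_coe, proj_mul, map_sum, map_smul,
    Finset.sum_mul, smul_mul_assoc, TensorProduct.tmul_sum, TensorProduct.smul_tmul]

theorem induction_mulMap (hb : Function.Bijective (mulMap i j)) {P : E → Prop}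
    (hadd : ∀ e f, P e → P f → P (e + f)) (h0 : P 0)
    (hmul : ∀ (a : A) (g : G), P (i a * j (single g 1))) (e : E) : P e := by
  obtain ⟨t, rfl⟩ := hb.2 e
  induction t with
  | zero => rwa [map_zero]
  | add s t hs ht => rw [map_add]; exact hadd _ _ hs ht
  | tmul a y =>
    induction y using MonoidAlgebra.induction_linear with
    | zero => rwa [TensorProduct.tmul_zero, map_zero]
    | add y z hy hz => rw [TensorProduct.tmul_add, map_add]; exact hadd _ _ hy hz
    | single g c =>
      have : a ⊗ₜ[K] single g c = (c • a) ⊗ₜ[K] single g 1 := by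
        rw [TensorProduct.smul_tmul, smul_single, smul_eq_mul, mul_one]
      rw [this]
      exact hmul _ g

/-- Both coactions agree since group-like elements are cocommutative. -/
theorem comm_lTensor_proj_comul (e : E) : TensorProduct.comm K E _
    ((proj hb : E →ₗ[K] MonoidAlgebra K G).lTensor E (comul (R := K) e)) =
      (proj hb : E →ₗ[K] MonoidAlgebra K G).rTensor E (comul (R := K) e) := by
  induction e using induction_mulMap hb with
  | hadd e f he hf => simp only [map_add, he, hf]
  | h0 => simp only [map_zero]
  | hmul a g => rw [lTensor_proj_comul, rTensor_proj_comul, TensorProduct.comm_tmul]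

/-- The elements of degree `g` are those of `i A * j g`. -/
theorem exists_eq_mul_j_single {e : E} {g : G}
    (he : (proj hb : E →ₗ[K] MonoidAlgebra K G).lTensor E (comul (R := K) e) = e ⊗ₜ single g 1) :
    ∃ a : A, e = i a * j (single g 1) := by
  classical
  -- The coefficient functional at `g`, applied to the coaction, extracts the degree `g` component.
  let c : MonoidAlgebra K G →ₗ[K] K := Finsupp.lapply g ∘ₗ (coeffLinearEquiv K).toLinearMap
  have hc (k : G) : c (single k 1) = if k = g then 1 else 0 := by
    simp [c, coeffLinearEquiv, Finsupp.single_apply]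
  have key (e : E) : ∃ a : A, TensorProduct.rid K E (c.lTensor E
      ((proj hb : E →ₗ[K] MonoidAlgebra K G).lTensor E (comul (R := K) e))) =
      i a * j (single g 1) := by
    induction e using induction_mulMap hb with
    | hadd e f he hf =>
      obtain ⟨a, ha⟩ := he
      obtain ⟨b, hb'⟩ := hf
      exact ⟨a + b, by simp only [map_add, ha, hb', add_mul]⟩
    | h0 => exact ⟨0, by simp⟩
    | hmul a k =>
      rw [lTensor_proj_comul, LinearMap.lTensor_tmul, TensorProduct.rid_tmul, hc]
      split_ifs with h
      · exact ⟨a, by rw [h, one_smul]⟩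
      · exact ⟨0, by simp⟩
  obtain ⟨a, ha⟩ := key e
  refine ⟨a, ?_⟩
  rw [← ha, he, LinearMap.lTensor_tmul, TensorProduct.rid_tmul, hc, if_pos rfl, one_smul]

end Coaction

/-! ### Factorizations through a Taft algebra and a group algebra -/

section Taft

open TaftAlgebra

variable {K : Type*} [Field K] {m : ℕ} [Nat.AtLeastTwo m] {q : K}
  [hq : Fact (IsPrimitiveRoot q m)] {E : Type*} [Ring E] [HopfAlgebra K E] {G : Type*} [Group G]
  {i : TaftAlgebra K m q →ₐc[K] E} {j : MonoidAlgebra K G →ₐc[K] E}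

variable (i j) in
theorem comul_j_single_mul_x (g : G) : comul (R := K) (j (single g 1) * i (x K m q)) =
    (j (single g 1) * i (x K m q)) ⊗ₜ (j (single g 1) * i (h K m q)) +
      j (single g 1) ⊗ₜ (j (single g 1) * i (x K m q)) := by
  rw [Bialgebra.comul_mul, comul_j_single, ← CoalgHomClass.map_comp_comul_apply i, comul_x]
  simp [mul_add]

/-- With `p = proj hb` and `P = p (j g * i h)`, equality of the two coactions on `j g * i x` reads
`(g - P) ⊗ j g * i x = p (j g * i x) ⊗ j g * i (1 - h)`, so both sides vanish. -/
theorem proj_j_mul_h_and_x (hi : Function.Injective i) (hb : Function.Bijective (mulMap i j))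
    (g : G) :
    proj hb (j (single g 1) * i (h K m q)) = single g 1 ∧
      proj hb (j (single g 1) * i (x K m q)) = 0 := by
  let f : TaftAlgebra K m q →ₗ[K] E := LinearMap.mulLeft K (j (single g 1)) ∘ₗ (i : _ →ₗ[K] E)
  have hf (a : TaftAlgebra K m q) : f a = j (single g 1) * i a := rfl
  have hfinj : Function.Injective f := by
    refine Function.Injective.comp (g := fun e => j (single g 1) * e) ?_ hi
    refine Function.LeftInverse.injective (g := fun e => j (single g⁻¹ 1) * e) fun e => ?_
    simp only [← mul_assoc, j_single_inv_mul, one_mul]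
  have hc := comm_lTensor_proj_comul hb (f (x K m q))
  rw [hf, comul_j_single_mul_x] at hc
  simp only [map_add, LinearMap.lTensor_tmul, LinearMap.rTensor_tmul, TensorProduct.comm_tmul,
    LinearMap.coe_coe, proj_j, ← hf] at hc
  have key : (single g 1 - proj hb (f (h K m q))) ⊗ₜ[K] f (x K m q) =
      proj hb (f (x K m q)) ⊗ₜ[K] f (1 - h K m q) := by
    have hf1 : f 1 = j (single g 1) := by rw [hf, map_one, mul_one]
    rw [map_sub, TensorProduct.sub_tmul, TensorProduct.tmul_sub, sub_eq_sub_iff_add_eq_add, hf1,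
      add_comm, ← hc, add_comm]
  obtain ⟨h1, h2⟩ := eq_zero_of_tmul_map_x_eq hq.out hfinj key
  exact ⟨(sub_eq_zero.1 h1).symm, h2⟩

/-- Each `j g` normalizes the Taft algebra: `j g * i h` and `j g * i x` have degree `g`. -/
theorem exists_j_mul_eq (hi : Function.Injective i) (hb : Function.Bijective (mulMap i j))
    (g : G) (a : TaftAlgebra K m q) :
    ∃ b, j (single g 1) * i a = i b * j (single g 1) := by
  obtain ⟨hh, hx⟩ := proj_j_mul_h_and_x hi hb g
  have degree_h : (proj hb : E →ₗ[K] MonoidAlgebra K G).lTensor E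
      (comul (R := K) (j (single g 1) * i (h K m q))) =
        (j (single g 1) * i (h K m q)) ⊗ₜ single g 1 := by
    rw [Bialgebra.comul_mul, comul_j_single, ← CoalgHomClass.map_comp_comul_apply i, comul_h]
    simp [hh]
  have degree_x : (proj hb : E →ₗ[K] MonoidAlgebra K G).lTensor E
      (comul (R := K) (j (single g 1) * i (x K m q))) =
        (j (single g 1) * i (x K m q)) ⊗ₜ single g 1 := by
    rw [comul_j_single_mul_x]
    simp [hh, hx]
  let B : Subalgebra K (TaftAlgebra K m q) :=
    { carrier := {a | ∃ b, j (single g 1) * i a = i b * j (single g 1)}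
      mul_mem' := by
        rintro a b ⟨a', ha⟩ ⟨b', hb'⟩
        exact ⟨a' * b', by rw [map_mul, map_mul, ← mul_assoc, ha, mul_assoc, hb', mul_assoc]⟩
      add_mem' := by
        rintro a b ⟨a', ha⟩ ⟨b', hb'⟩
        exact ⟨a' + b', by rw [map_add, map_add, mul_add, add_mul, ha, hb']⟩
      algebraMap_mem' := fun c => ⟨algebraMap K _ c, by
        rw [AlgHomClass.commutes, Algebra.commutes]⟩ }
  exact mem_of_h_mem_of_x_mem B (exists_eq_mul_j_single hb degree_h)
    (exists_eq_mul_j_single hb degree_x) a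

end Taft

end GroupFactorization

end

theorem mainTheorem1 {K : Type*} [Field K] {m : ℕ} [Nat.AtLeastTwo m] {q : K}
    [Fact (IsPrimitiveRoot q m)] {G : Type*} [Group G] (S : Set G)
    (hS : ∀ g ∈ S, IsOfFinOrder g) (hG : Subgroup.closure S = ⊤) :
    (∀ (E : Type*) [Ring E] [HopfAlgebra K E],
      FactorizesThrough K E (TaftAlgebra K m q) (MonoidAlgebra K G) →
      ∃ α : SmashAction K (TaftAlgebra K m q) (MonoidAlgebra K G),
        Nonempty (E ≃ₐc[K] SmashProduct α)) ∧
    ∀ P : HopfMatchedPair K (TaftAlgebra K m q) (MonoidAlgebra K G), P.RightTrivial := by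
  refine ⟨fun E _ _ => ?_, fun P => P.rightTrivial_of_taft⟩
  rintro ⟨i, j, hi, -, hb⟩
  have hb' : Function.Bijective (GroupFactorization.mulMap i j) := hb
  exact GroupFactorization.exists_smashProduct_equiv hi hb'
    (GroupFactorization.exists_j_mul_eq hi hb')
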